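/- Let $N\ge 2$, let $t_1<\dots<t_N$ be real numbers, and let $p,q$ be real polynomials without common real zeros such that the real zeros of $p$ are exactly $t_1,\dots,t_N$, $p'(t_j)\neq 0$ for $j=1,\dots,N$, and $q$ has at most one zero in $]t_j,t_{j+1}[$ for each $j=1,\dots,N-1$. Let $L=p(t)\partial_t+q(t)\partial_x$ act on the space $C^\infty(\mathbb{R}^2)$ of (real- or complex-valued) smooth functions of $(t,x)$. For $j\in\{1,\dots,N-1\}$ call the strip $S_j=\,]t_j,t_{j+1}[\,\times\mathbb{R}$ a separatrix for $L$ if for every $(\tau,y)\in S_j$ the characteristic curve $x(t)=x(t;\tau,y)$, i.e. the solution on $]t_j,t_{j+1}[$ of $\dot x(t)=q(t)/p(t)$, $x(\tau)=y$, satisfies either $\lim_{t\to t_j^+}x(t)=\lim_{t\to t_{j+1}^-}x(t)=+\infty$ or $\lim_{t\to t_j^+}x(t)=\lim_{t\to t_{j+1}^-}x(t)=-\infty$. Then the following assertions are equivalent: (i) $L$ is not surjective in $C^\infty(\mathbb{R}^2)$, i.e. there is $f\in C^\infty(\mathbb{R}^2)$ such that $Lu=f$ has no solution $u\in C^\infty(\mathbb{R}^2)$;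 (ii) $S_j$ is a separatrix for $L$ for some $j\in\{1,\dots,N-1\}$; (iii) there exist $j\in\{1,\dots,N-1\}$ and $\theta_j\in\,]t_j,t_{j+1}[$ such that $q(\theta_j)=0$ and $q$ has opposite (strict) signs in $]t_j,\theta_j[$ and $]\theta_j,t_{j+1}[$. In particular, for every real $\lambda\neq 0$ and every integer $k\ge 0$, the operator $L_{\lambda,k}=(1-t^2)\partial_t+\lambda t^k\partial_x$ is not surjective in $C^\infty(\mathbb{R}^2)$ if and only if $k$ is odd. -/

import Mathlib

open Filter Topology Set Polynomial
open scoped ContDiff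

/-- The operator `L u = p(t) ∂ₜ u + q(t) ∂ₓ u`, acting on functions of `(t, x) ∈ ℝ × ℝ`. -/
noncomputable def planeField {𝕜 : Type*} [RCLike 𝕜] (p q : ℝ[X]) (u : ℝ × ℝ → 𝕜) :
    ℝ × ℝ → 𝕜 :=
  fun z => p.eval z.1 • fderiv ℝ u z (1, 0) + q.eval z.1 • fderiv ℝ u z (0, 1)

/-- The space `C^∞(ℝ²)` of smooth `𝕜`-valued functions (`𝕜` is `ℝ` or `ℂ`). -/
def smoothPlane (𝕜 : Type*) [RCLike 𝕜] : Set (ℝ × ℝ → 𝕜) :=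
  {u | ContDiff ℝ ∞ u}

/-- `L` is surjective in `C^∞(ℝ²)`: every smooth `f` is `L u` for some smooth `u`. -/
def SurjectiveOnSmooth (𝕜 : Type*) [RCLike 𝕜] (p q : ℝ[X]) : Prop :=
  SurjOn (planeField p q) (smoothPlane 𝕜) (smoothPlane 𝕜)

/-- `x` is the characteristic curve `x = x(t; τ, y)` of `L` in the strip `]a, b[ × ℝ`
(on which `p` has no zeros): `dx/dt = q/p` on `]a, b[` and `x(τ) = y`. -/
def IsCharacteristic (p q : ℝ[X]) (a b τ y : ℝ) (x : ℝ → ℝ) : Prop :=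
  (∀ t ∈ Ioo a b, HasDerivAt x (q.eval t / p.eval t) t) ∧ x τ = y

/-- The strip `]a, b[ × ℝ` is a separatrix for `L`. -/
def IsSeparatrix (p q : ℝ[X]) (a b : ℝ) : Prop :=
  ∀ τ ∈ Ioo a b, ∀ y : ℝ, ∀ x : ℝ → ℝ, IsCharacteristic p q a b τ y x →
    (Tendsto x (𝓝[>] a) atTop ∧ Tendsto x (𝓝[<] b) atTop) ∨
    (Tendsto x (𝓝[>] a) atBot ∧ Tendsto x (𝓝[<] b) atBot)

/-- `f` has opposite signs in `]a, θ[` and `]θ, b[`. -/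
def OppositeSigns (f : ℝ → ℝ) (a θ b : ℝ) : Prop :=
  ((∀ s ∈ Ioo a θ, 0 < f s) ∧ (∀ s ∈ Ioo θ b, f s < 0)) ∨
  ((∀ s ∈ Ioo a θ, f s < 0) ∧ (∀ s ∈ Ioo θ b, 0 < f s))

/-!
The operator `L = p ∂ₜ + q ∂ₓ` is surjective exactly when `q` has one sign on the zeros of `p`.

If that sign is positive, the shear `x ↦ x + h(t)` with `h' = p / (√(p² + q²) + q)` replaces `q` by
`√(p² + q²)`, which has no zeros. Dividing by it leaves `a ∂ₜ + ∂ₓ` with `|a| ≤ 1`, whose equation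
is solved by integrating along the flow of `a`. A negative sign reduces to this one by passing to
`-L`.

Otherwise `q` has opposite signs at two consecutive zeros `a < b` of `p`. Since `p'(a)` and `p'(b)`
have opposite signs too, a characteristic `X` on `]a, b[` tends to the same infinity at both ends,
with logarithmic rate. Hence there are `s` near `a` and `t` near `b` with `X s = X t`, so that a
translate of `X` joins `(s, 0)` to `(t, 0)`. If `L u = e` for a constant `e ≠ 0`, then
`u (t, 0) - u (s, 0)` is `e` times the travel time `∫ₛᵗ dr / p(r)`, which is unbounded as `s → a`
and `t → b`, whereas `u (·, 0)` is bounded on `[a, b]`.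
-/

section ParametricIntegrals

variable {E : Type*} [NormedAddCommGroup E] [NormedSpace ℝ E]

theorem hasDerivAt_comp_prodMk {u : ℝ × ℝ → E} {α β : ℝ → ℝ} {α' β' s : ℝ}
    (hu : DifferentiableAt ℝ u (α s, β s)) (hα : HasDerivAt α α' s) (hβ : HasDerivAt β β' s) :
    HasDerivAt (fun r => u (α r, β r)) (fderiv ℝ u (α s, β s) (α', β')) s :=
  hu.hasFDerivAt.comp_hasDerivAt s (hα.prodMk hβ)

theorem hasFDerivAt_of_continuous_partials {G G₁ G₂ : ℝ × ℝ → E}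
    (h₁ : ∀ x y, HasDerivAt (fun r => G (r, y)) (G₁ (x, y)) x)
    (h₂ : ∀ x y, HasDerivAt (fun r => G (x, r)) (G₂ (x, y)) y)
    (c₁ : Continuous G₁) (c₂ : Continuous G₂) (z : ℝ × ℝ) :
    HasFDerivAt G ((ContinuousLinearMap.toSpanSingleton ℝ (G₁ z)).coprod
      (ContinuousLinearMap.toSpanSingleton ℝ (G₂ z))) z :=
  (hasStrictFDerivAt_uncurry_coprod (𝕜 := ℝ) (u := z) (f := fun x y => G (x, y))
    (f₁ := fun x y => ContinuousLinearMap.toSpanSingleton ℝ (G₁ (x, y)))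
    (f₂ := fun x y => ContinuousLinearMap.toSpanSingleton ℝ (G₂ (x, y)))
    (Eventually.of_forall fun v => (h₁ v.1 v.2).hasFDerivAt)
    (Eventually.of_forall fun v => (h₂ v.1 v.2).hasFDerivAt)
    ((ContinuousLinearMap.toSpanSingletonCLE (𝕜 := ℝ)).continuous.comp c₁).continuousAt
    ((ContinuousLinearMap.toSpanSingletonCLE (𝕜 := ℝ)).continuous.comp c₂).continuousAt).hasFDerivAt

theorem contDiff_succ_of_partials {n : ℕ} {G G₁ G₂ : ℝ × ℝ → E}
    (h₁ : ∀ x y, HasDerivAt (fun r => G (r, y)) (G₁ (x, y)) x)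
    (h₂ : ∀ x y, HasDerivAt (fun r => G (x, r)) (G₂ (x, y)) y)
    (c₁ : ContDiff ℝ n G₁) (c₂ : ContDiff ℝ n G₂) : ContDiff ℝ (n + 1 : ℕ) G := by
  rw [Nat.cast_add, Nat.cast_one, contDiff_succ_iff_hasFDerivAt]
  refine ⟨_, ?_, hasFDerivAt_of_continuous_partials h₁ h₂ c₁.continuous c₂.continuous⟩
  have e₁ := (ContinuousLinearMap.toSpanSingletonCLE (𝕜 := ℝ) (E := E)).contDiff.comp c₁
  have e₂ := (ContinuousLinearMap.toSpanSingletonCLE (𝕜 := ℝ) (E := E)).contDiff.comp c₂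
  exact (ContinuousLinearMap.coprodEquivL ℝ (E := ℝ) (F := ℝ) (G := E)).contDiff.comp (e₁.prodMk e₂)

theorem hasDerivAt_integral_of_continuous_deriv {H H₂ : ℝ × ℝ → E} (cH : Continuous H)
    (h₂ : ∀ x y, HasDerivAt (fun r => H (x, r)) (H₂ (x, y)) y) (c₂ : Continuous H₂) (a b y : ℝ) :
    HasDerivAt (fun y => ∫ r in a..b, H (r, y)) (∫ r in a..b, H₂ (r, y)) y := by
  obtain ⟨M, hM⟩ := (isCompact_uIcc.prod (isCompact_closedBall y 1)).exists_bound_of_continuousOn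
    (s := uIcc a b ×ˢ Metric.closedBall y 1) c₂.continuousOn
  refine (intervalIntegral.hasDerivAt_integral_of_dominated_loc_of_deriv_le
    (F := fun y r => H (r, y)) (F' := fun y r => H₂ (r, y)) (bound := fun _ => M)
    (Metric.closedBall_mem_nhds y one_pos) (Eventually.of_forall fun x => ?_) ?_ ?_
    (Eventually.of_forall fun r hr x hx => hM (r, x) ⟨uIoc_subset_uIcc hr, hx⟩)
    intervalIntegrable_const (Eventually.of_forall fun r _ x _ => h₂ r x)).2
  · exact (cH.comp (by fun_prop)).aestronglyMeasurable
  · exact (cH.comp (by fun_prop)).intervalIntegrable _ _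
  · exact (c₂.comp (by fun_prop)).aestronglyMeasurable

theorem contDiff_integral_fst [CompleteSpace E] (n : ℕ) {H : ℝ × ℝ → E} (hH : ContDiff ℝ n H)
    (a : ℝ) : ContDiff ℝ n fun z : ℝ × ℝ => ∫ r in a..z.1, H (r, z.2) := by
  induction n generalizing H with
  | zero =>
    rw [Nat.cast_zero, contDiff_zero] at hH ⊢
    exact intervalIntegral.continuous_parametric_intervalIntegral_of_continuous
      (f := fun (z : ℝ × ℝ) r => H (r, z.2)) (by fun_prop) continuous_fst
  | succ n ih =>
    have hdiff : Differentiable ℝ H := hH.differentiable (by simp)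
    have hD : ContDiff ℝ n fun z => fderiv ℝ H z (0, 1) :=
      (hH.fderiv_right (m := n) (by norm_cast)).clm_apply contDiff_const
    refine contDiff_succ_of_partials (fun x y => ?_) (fun x y => ?_)
      (hH.of_le (by exact_mod_cast n.le_succ)) (ih hD)
    · exact ((hH.continuous.comp (by fun_prop)).integral_hasStrictDerivAt
        (f := fun r => H (r, y)) a x).hasDerivAt
    · exact hasDerivAt_integral_of_continuous_deriv hH.continuous
        (fun x y => hasDerivAt_comp_prodMk (hdiff _) (hasDerivAt_const y x) (hasDerivAt_id' y))
        hD.continuous a x y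

end ParametricIntegrals

section IntegralCurves

variable {E : Type*} [NormedAddCommGroup E] [NormedSpace ℝ E] [ProperSpace E]

theorem exists_hasDerivAt_Ioo_of_bounded {v : E → E} (hv : ContDiff ℝ 1 v) {M : NNReal}
    (hM : ∀ x, ‖v x‖ ≤ M) (x : E) (R : ℝ) :
    ∃ γ : ℝ → E, γ 0 = x ∧ ∀ s ∈ Ioo (-R) R, HasDerivAt γ (v (γ s)) s := by
  rcases le_or_gt R 0 with hR | hR
  · exact ⟨fun _ => x, rfl, fun s hs => by linarith [hs.1, hs.2]⟩
  lift R to NNReal using hR.le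
  obtain ⟨K, hK⟩ := hv.locallyLipschitz.locallyLipschitzOn.exists_lipschitzOnWith_of_compact
    (isCompact_closedBall x (M * R : NNReal))
  have hPL : IsPicardLindelof (fun _ => v) (tmin := -R) (tmax := R)
      ⟨0, by simp⟩ x (M * R) 0 M K :=
    IsPicardLindelof.of_time_independent (fun y _ => hM y) hK (by simp)
  obtain ⟨γ, h0, hγ⟩ := hPL.exists_eq_forall_mem_Icc_hasDerivWithinAt₀
  exact ⟨γ, h0, fun s hs => (hγ s (Ioo_subset_Icc_self hs)).hasDerivAt (Icc_mem_nhds hs.1 hs.2)⟩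

theorem exists_isIntegralCurve_of_bounded {v : E → E} (hv : ContDiff ℝ 1 v) {M : NNReal}
    (hM : ∀ x, ‖v x‖ ≤ M) (x : E) : ∃ γ : ℝ → E, γ 0 = x ∧ IsIntegralCurve γ fun _ => v := by
  obtain ⟨γ, h0, hγ⟩ := (exists_isMIntegralCurve_iff_exists_isMIntegralCurveOn_Ioo (v := v)
    (contMDiff_vectorSpace_iff_contDiff.2 hv) x).2 fun R => by
      obtain ⟨γ, h0, hγ⟩ := exists_hasDerivAt_Ioo_of_bounded hv hM x R
      exact ⟨γ, h0, fun s hs => ((hγ s hs).hasFDerivAt.hasFDerivWithinAt).hasMFDerivWithinAt⟩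
  refine ⟨γ, h0, fun s => ?_⟩
  have hs : HasFDerivAt γ (ContinuousLinearMap.toSpanSingleton ℝ (v (γ s))) s := (hγ s).hasFDerivAt
  simpa using hs.hasDerivAt

end IntegralCurves

section Flow

/-- The mean value of `a'` over the segment from `z.1` to `z.2`. It is Hadamard's quotient: the
continuous extension to the diagonal of the slope of `a`. -/
noncomputable def meanDeriv (a : ℝ → ℝ) (z : ℝ × ℝ) : ℝ :=
  ∫ σ in (0 : ℝ)..1, deriv a (z.1 + σ * (z.2 - z.1))

theorem continuous_meanDeriv {a : ℝ → ℝ} (ha : ContDiff ℝ 1 a) : Continuous (meanDeriv a) := by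
  have := ha.continuous_deriv le_rfl
  exact intervalIntegral.continuous_parametric_intervalIntegral_of_continuous'
    (f := fun (z : ℝ × ℝ) σ => deriv a (z.1 + σ * (z.2 - z.1))) (by fun_prop) 0 1

theorem meanDeriv_self (a : ℝ → ℝ) (x : ℝ) : meanDeriv a (x, x) = deriv a x := by
  simp [meanDeriv]

theorem sub_eq_meanDeriv_mul {a : ℝ → ℝ} (ha : ContDiff ℝ 1 a) (x y : ℝ) :
    a y - a x = meanDeriv a (x, y) * (y - x) := by
  have ha' := ha.continuous_deriv le_rfl
  have hline (σ : ℝ) : HasDerivAt (fun σ : ℝ => x + σ * (y - x)) (y - x) σ := by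
    simpa using ((hasDerivAt_id σ).mul_const (y - x)).const_add x
  have hcomp (σ : ℝ) : HasDerivAt (fun σ => a (x + σ * (y - x)))
      (deriv a (x + σ * (y - x)) * (y - x)) σ :=
    (ha.differentiable one_ne_zero _).hasDerivAt.comp σ (hline σ)
  have := intervalIntegral.integral_eq_sub_of_hasDerivAt (fun σ _ => hcomp σ)
    (((ha'.comp (by fun_prop)).mul continuous_const).intervalIntegrable 0 1)
  rw [intervalIntegral.integral_mul_const] at this
  simpa [meanDeriv] using this.symm

theorem integralCurve_sub_eq {a : ℝ → ℝ} (ha : ContDiff ℝ 1 a) {γ δ : ℝ → ℝ}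
    (hγ : IsIntegralCurve γ fun _ => a) (hδ : IsIntegralCurve δ fun _ => a) (s : ℝ) :
    δ s - γ s = (δ 0 - γ 0) * Real.exp (∫ r in (0 : ℝ)..s, meanDeriv a (γ r, δ r)) := by
  set I : ℝ → ℝ := fun s => ∫ r in (0 : ℝ)..s, meanDeriv a (γ r, δ r)
  have hI (s : ℝ) : HasDerivAt I (meanDeriv a (γ s, δ s)) s :=
    (((continuous_meanDeriv ha).comp
      (hγ.continuous.prodMk hδ.continuous)).integral_hasStrictDerivAt 0 s).hasDerivAt
  have hW (s : ℝ) : HasDerivAt (fun s => (δ s - γ s) * Real.exp (-I s)) 0 s := by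
    refine (((hδ s).sub (hγ s)).mul (hI s).neg.exp).congr_deriv ?_
    simp only [Pi.sub_apply, Pi.neg_apply, sub_eq_meanDeriv_mul ha (γ s) (δ s)]
    ring
  have hconst : (δ s - γ s) * Real.exp (-I s) = δ 0 - γ 0 := by
    simpa [I] using is_const_of_deriv_eq_zero (fun s => (hW s).differentiableAt)
      (fun s => (hW s).deriv) s 0
  rw [← hconst, mul_assoc, ← Real.exp_add, neg_add_cancel, Real.exp_zero, mul_one]

theorem integralCurve_unique {a : ℝ → ℝ} (ha : ContDiff ℝ 1 a) {γ δ : ℝ → ℝ}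
    (hγ : IsIntegralCurve γ fun _ => a) (hδ : IsIntegralCurve δ fun _ => a) (h0 : γ 0 = δ 0) :
    γ = δ := by
  funext s
  have := integralCurve_sub_eq ha hγ hδ s
  rw [h0, sub_self, zero_mul, sub_eq_zero] at this
  exact this.symm

/-- `Φ` is the global flow of the vector field `a` on the line: `s ↦ Φ (s, t)` is the integral
curve of `a` through `t`. -/
structure IsFlow (a : ℝ → ℝ) (Φ : ℝ × ℝ → ℝ) : Prop where
  zero (t : ℝ) : Φ (0, t) = t
  isIntegralCurve (t : ℝ) : IsIntegralCurve (fun s => Φ (s, t)) fun _ => a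

theorem exists_isFlow {a : ℝ → ℝ} (ha : ContDiff ℝ 1 a) {M : NNReal} (hM : ∀ x, ‖a x‖ ≤ M) :
    ∃ Φ, IsFlow a Φ := by
  choose γ h0 hγ using exists_isIntegralCurve_of_bounded ha hM
  exact ⟨fun z => γ z.2 z.1, h0, hγ⟩

namespace IsFlow

variable {a : ℝ → ℝ} {Φ : ℝ × ℝ → ℝ}

theorem apply_neg_apply (h : IsFlow a Φ) (ha : ContDiff ℝ 1 a) (s t : ℝ) :
    Φ (-s, Φ (s, t)) = t := by
  have hshift := integralCurve_unique ha (h.isIntegralCurve (Φ (s, t)))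
    ((h.isIntegralCurve t).comp_add s) (by simp [h.zero])
  simpa [h.zero] using congrFun hshift (-s)

theorem apply_apply_neg (h : IsFlow a Φ) (ha : ContDiff ℝ 1 a) (s t : ℝ) :
    Φ (s, Φ (-s, t)) = t := by
  simpa using h.apply_neg_apply ha (-s) t

theorem sub_eq (h : IsFlow a Φ) (ha : ContDiff ℝ 1 a) (s t τ : ℝ) :
    Φ (s, τ) - Φ (s, t) =
      (τ - t) * Real.exp (∫ r in (0 : ℝ)..s, meanDeriv a (Φ (r, t), Φ (r, τ))) := by
  simpa only [h.zero] using
    integralCurve_sub_eq ha (h.isIntegralCurve t) (h.isIntegralCurve τ) s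

theorem strictMono (h : IsFlow a Φ) (ha : ContDiff ℝ 1 a) (s : ℝ) :
    StrictMono fun t => Φ (s, t) := fun t τ htτ => by
  rw [← sub_pos, h.sub_eq ha]
  exact mul_pos (sub_pos.2 htτ) (Real.exp_pos _)

theorem continuous (h : IsFlow a Φ) (ha : ContDiff ℝ 1 a) {M : NNReal} (hM : ∀ x, ‖a x‖ ≤ M) :
    Continuous Φ := by
  refine continuous_prod_of_continuous_lipschitzWith Φ M (fun s => ?_) fun t => ?_
  · -- a monotone bijection of the line is continuous
    exact (h.strictMono ha s).monotone.continuous_of_surjective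
      fun t => ⟨Φ (-s, t), h.apply_apply_neg ha s t⟩
  · exact lipschitzWith_of_nnnorm_deriv_le (fun s => (h.isIntegralCurve t s).differentiableAt)
      fun s => (h.isIntegralCurve t s).deriv ▸ hM _

theorem hasDerivAt_snd (h : IsFlow a Φ) (ha : ContDiff ℝ 1 a) (hΦ : Continuous Φ) (s t : ℝ) :
    HasDerivAt (fun τ => Φ (s, τ)) (Real.exp (∫ r in (0 : ℝ)..s, deriv a (Φ (r, t)))) t := by
  have hslope : Continuous fun τ =>
      Real.exp (∫ r in (0 : ℝ)..s, meanDeriv a (Φ (r, t), Φ (r, τ))) :=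
    Real.continuous_exp.comp
      (intervalIntegral.continuous_parametric_intervalIntegral_of_continuous'
        (f := fun τ r => meanDeriv a (Φ (r, t), Φ (r, τ)))
        ((continuous_meanDeriv ha).comp (by fun_prop)) 0 s)
  have hlim := (hslope.tendsto t).mono_left (nhdsWithin_le_nhds (s := {t}ᶜ))
  simp only [meanDeriv_self] at hlim
  refine hasDerivAt_iff_tendsto_slope.2 (hlim.congr' ?_)
  filter_upwards [self_mem_nhdsWithin] with τ hτ
  rw [slope_def_field, h.sub_eq ha, mul_div_cancel_left₀ _ (sub_ne_zero.2 hτ)]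

theorem contDiff (h : IsFlow a Φ) (ha : ContDiff ℝ ∞ a) {M : NNReal} (hM : ∀ x, ‖a x‖ ≤ M) :
    ContDiff ℝ ∞ Φ := by
  have ha1 : ContDiff ℝ 1 a := ha.of_le (by exact_mod_cast le_top)
  have hc := h.continuous ha1 hM
  refine contDiff_infty.2 fun n => ?_
  induction n with
  | zero => exact contDiff_zero.2 hc
  | succ n ih =>
    have han : ContDiff ℝ n a := ha.of_le (by exact_mod_cast le_top)
    have ha' : ContDiff ℝ n (deriv a) :=
      (contDiff_infty_iff_deriv.1 ha).2.of_le (by exact_mod_cast le_top)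
    exact contDiff_succ_of_partials (fun s t => h.isIntegralCurve t s)
      (fun s t => h.hasDerivAt_snd ha1 hc s t) (han.comp ih)
      (contDiff_integral_fst n (ha'.comp ih) 0).exp

end IsFlow

end Flow

section Surjectivity

variable {E : Type*} [NormedAddCommGroup E] [NormedSpace ℝ E]

/-- Surjectivity of `p(t) ∂ₜ + q(t) ∂ₓ` on `C^∞(ℝ², E)`, for coefficients that need not be
polynomials. The operator is encoded as the derivative in the direction `(p, q)`. -/
def IsSmoothlySurjective (E : Type*) [NormedAddCommGroup E] [NormedSpace ℝ E] (p q : ℝ → ℝ) :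
    Prop :=
  ∀ f : ℝ × ℝ → E, ContDiff ℝ ∞ f →
    ∃ u : ℝ × ℝ → E, ContDiff ℝ ∞ u ∧ ∀ z, fderiv ℝ u z (p z.1, q z.1) = f z

theorem surjectiveOnSmooth_iff (𝕜 : Type*) [RCLike 𝕜] (p q : ℝ[X]) :
    SurjectiveOnSmooth 𝕜 p q ↔ IsSmoothlySurjective 𝕜 (fun s => p.eval s) fun s => q.eval s := by
  have hfield (u : ℝ × ℝ → 𝕜) (z : ℝ × ℝ) :
      planeField p q u z = fderiv ℝ u z (p.eval z.1, q.eval z.1) := by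
    rw [planeField, ← map_smul, ← map_smul, ← map_add]
    simp
  simp only [SurjectiveOnSmooth, SurjOn, smoothPlane, subset_def, mem_image, mem_ofPred_eq,
    IsSmoothlySurjective, funext_iff, hfield]

namespace IsSmoothlySurjective

theorem of_isFlow [CompleteSpace E] {a : ℝ → ℝ} {Φ : ℝ × ℝ → ℝ} (h : IsFlow a Φ)
    (ha : ContDiff ℝ 1 a) (hΦ : ContDiff ℝ ∞ Φ) : IsSmoothlySurjective E a fun _ => 1 := by
  intro f hf
  -- `G (s, t₀)` is the integral of `f` along the characteristic from `(t₀, 0)` up to height `s`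
  set G : ℝ × ℝ → E := fun z => ∫ r in (0 : ℝ)..z.1, f (Φ (r, z.2), r)
  have hfΦ : ContDiff ℝ ∞ fun z : ℝ × ℝ => f (Φ z, z.1) := hf.comp (hΦ.prodMk contDiff_fst)
  have hG : ContDiff ℝ ∞ G := contDiff_infty.2 fun n =>
    contDiff_integral_fst n (hfΦ.of_le (by exact_mod_cast le_top)) 0
  have hu : ContDiff ℝ ∞ fun z : ℝ × ℝ => G (z.2, Φ (-z.2, z.1)) :=
    hG.comp (contDiff_snd.prodMk (hΦ.comp (contDiff_snd.neg.prodMk contDiff_fst)))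
  refine ⟨_, hu, fun ⟨t, x⟩ => ?_⟩
  set t₀ := Φ (-x, t)
  have hchain := hasDerivAt_comp_prodMk (hu.differentiable (by simp) _)
    (h.isIntegralCurve t₀ x) (hasDerivAt_id' x)
  have hftc : HasDerivAt (fun s => G (s, t₀)) (f (Φ (x, t₀), x)) x :=
    ((hfΦ.continuous.comp (f := fun r : ℝ => (r, t₀)) (by fun_prop)).integral_hasStrictDerivAt
      0 x).hasDerivAt
  simp only [h.apply_neg_apply ha] at hchain
  simpa only [t₀, h.apply_apply_neg ha] using hchain.unique hftc

theorem of_bounded [CompleteSpace E] {a : ℝ → ℝ} (ha : ContDiff ℝ ∞ a) {M : NNReal}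
    (hM : ∀ x, ‖a x‖ ≤ M) : IsSmoothlySurjective E a fun _ => 1 := by
  have ha1 : ContDiff ℝ 1 a := ha.of_le (by exact_mod_cast le_top)
  obtain ⟨Φ, hΦ⟩ := exists_isFlow ha1 hM
  exact of_isFlow hΦ ha1 (hΦ.contDiff ha hM)

theorem mul_left {p q c : ℝ → ℝ} (h : IsSmoothlySurjective E p q) (hc : ContDiff ℝ ∞ c)
    (hc0 : ∀ s, c s ≠ 0) : IsSmoothlySurjective E (c * p) (c * q) := fun f hf => by
  obtain ⟨u, hu, huf⟩ := h (fun z => (c z.1)⁻¹ • f z)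
    (((hc.comp contDiff_fst).inv fun z => hc0 z.1).smul hf)
  refine ⟨u, hu, fun z => ?_⟩
  calc fderiv ℝ u z ((c * p) z.1, (c * q) z.1)
      = c z.1 • fderiv ℝ u z (p z.1, q z.1) := by rw [← map_smul]; rfl
    _ = f z := by rw [huf, smul_inv_smul₀ (hc0 z.1)]

theorem of_shear {p q h : ℝ → ℝ} (hh : ContDiff ℝ ∞ h)
    (H : IsSmoothlySurjective E p (q + p * deriv h)) : IsSmoothlySurjective E p q := fun f hf => by
  obtain ⟨v, hv, hvf⟩ := H (fun z => f (z.1, z.2 - h z.1))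
    (hf.comp (contDiff_fst.prodMk (contDiff_snd.sub (hh.comp contDiff_fst))))
  refine ⟨fun z => v (z.1, z.2 + h z.1),
    hv.comp (contDiff_fst.prodMk (contDiff_snd.add (hh.comp contDiff_fst))), fun z => ?_⟩
  have hd : HasFDerivAt (fun z : ℝ × ℝ => h z.1) (deriv h z.1 • ContinuousLinearMap.fst ℝ ℝ ℝ) z :=
    (hh.differentiable (by simp) z.1).hasDerivAt.comp_hasFDerivAt z hasFDerivAt_fst
  have hshear := hasFDerivAt_fst.prodMk (hasFDerivAt_snd.add hd)
  have hu := (hv.differentiable (by simp) (z.1, z.2 + h z.1)).hasFDerivAt.comp z hshear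
  rw [show fderiv ℝ (fun z : ℝ × ℝ => v (z.1, z.2 + h z.1)) z = _ from hu.fderiv]
  simpa [mul_comm] using hvf (z.1, z.2 + h z.1)

end IsSmoothlySurjective

theorem exists_contDiff_deriv_eq [CompleteSpace E] {g : ℝ → E} (hg : ContDiff ℝ ∞ g) :
    ∃ h : ℝ → E, ContDiff ℝ ∞ h ∧ deriv h = g := by
  have hd (s : ℝ) : HasDerivAt (fun s => ∫ r in (0 : ℝ)..s, g r) (g s) s :=
    (hg.continuous.integral_hasStrictDerivAt 0 s).hasDerivAt
  have hderiv := funext fun s => (hd s).deriv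
  exact ⟨_, contDiff_infty_iff_deriv.2 ⟨fun s => (hd s).differentiableAt, by rwa [hderiv]⟩, hderiv⟩

theorem sqrt_sq_add_sq_add_pos {x y : ℝ} (h : x = 0 → 0 < y) : 0 < √(x ^ 2 + y ^ 2) + y := by
  rcases eq_or_ne x 0 with hx | hx
  · exact add_pos_of_nonneg_of_pos (Real.sqrt_nonneg _) (h hx)
  · have : |y| < √(x ^ 2 + y ^ 2) :=
      Real.lt_sqrt_of_sq_lt (by rw [sq_abs]; exact lt_add_of_pos_left _ (by positivity))
    linarith [neg_abs_le y]

-- With `(y, x) = r (cos θ, sin θ)` this is `cos θ + sin θ * tan (θ / 2) = 1`.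
theorem add_mul_div_sqrt_sq_add_sq_add {x y : ℝ} (h : x = 0 → 0 < y) :
    y + x * (x / (√(x ^ 2 + y ^ 2) + y)) = √(x ^ 2 + y ^ 2) := by
  have hne := (sqrt_sq_add_sq_add_pos h).ne'
  have hsq : √(x ^ 2 + y ^ 2) ^ 2 = x ^ 2 + y ^ 2 := Real.sq_sqrt (by positivity)
  field_simp
  linarith

theorem abs_div_sqrt_sq_add_sq_le_one (x y : ℝ) : |x / √(x ^ 2 + y ^ 2)| ≤ 1 := by
  rw [abs_div, abs_of_nonneg (Real.sqrt_nonneg _)]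
  exact div_le_one_of_le₀ (Real.abs_le_sqrt (le_add_of_nonneg_right (sq_nonneg y)))
    (Real.sqrt_nonneg _)

theorem IsSmoothlySurjective.of_pos_at_zeros [CompleteSpace E] {p q : ℝ → ℝ}
    (hp : ContDiff ℝ ∞ p) (hq : ContDiff ℝ ∞ q) (hpos : ∀ s, p s = 0 → 0 < q s) :
    IsSmoothlySurjective E p q := by
  set ψ : ℝ → ℝ := fun s => √(p s ^ 2 + q s ^ 2)
  have hsq (s : ℝ) : 0 < p s ^ 2 + q s ^ 2 := by
    rcases eq_or_ne (p s) 0 with h | h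
    · exact add_pos_of_nonneg_of_pos (sq_nonneg _) (pow_pos (hpos s h) 2)
    · positivity
  have hψ : ContDiff ℝ ∞ ψ := ((hp.pow 2).add (hq.pow 2)).sqrt fun s => (hsq s).ne'
  have hψ0 (s : ℝ) : ψ s ≠ 0 := (Real.sqrt_pos.2 (hsq s)).ne'
  obtain ⟨h, hh, hderiv⟩ := exists_contDiff_deriv_eq
    (hp.div (hψ.add hq) fun s => (sqrt_sq_add_sq_add_pos (hpos s)).ne')
  have hshear : q + p * deriv h = ψ * fun _ => 1 := by
    funext s
    simpa [hderiv] using add_mul_div_sqrt_sq_add_sq_add (hpos s)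
  have hdiv : p = ψ * fun s => p s / ψ s := funext fun s => (mul_div_cancel₀ _ (hψ0 s)).symm
  refine of_shear hh ?_
  rw [hshear, hdiv]
  exact (of_bounded (M := 1) (hp.div hψ hψ0)
    fun s => abs_div_sqrt_sq_add_sq_le_one (p s) (q s)).mul_left hψ hψ0

theorem IsSmoothlySurjective.of_mul_pos_at_zeros [CompleteSpace E] {p q : ℝ → ℝ}
    (hp : ContDiff ℝ ∞ p) (hq : ContDiff ℝ ∞ q)
    (hsign : ∀ a b, p a = 0 → p b = 0 → 0 < q a * q b) : IsSmoothlySurjective E p q := by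
  by_cases hpos : ∀ s, p s = 0 → 0 < q s
  · exact of_pos_at_zeros hp hq hpos
  · push Not at hpos
    obtain ⟨a, ha, hqa⟩ := hpos
    have hneg : IsSmoothlySurjective E (-p) (-q) :=
      of_pos_at_zeros hp.neg hq.neg fun s hs =>
        neg_pos.2 (neg_of_mul_pos_left (hsign s a (neg_eq_zero.1 hs) ha) hqa)
    simpa only [neg_mul_neg, one_mul] using
      hneg.mul_left (c := -1) (contDiff_const (c := -1)) fun _ => by simp

end Surjectivity

section Asymptotics

theorem tendsto_atBot_of_tendsto_sub_mul_deriv {x x' : ℝ → ℝ} {e c : ℝ}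
    (hx : ∀ᶠ t in 𝓝[>] e, HasDerivAt x (x' t) t) (hc : 0 < c)
    (h : Tendsto (fun t => (t - e) * x' t) (𝓝[>] e) (𝓝 c)) : Tendsto x (𝓝[>] e) atBot := by
  obtain ⟨d, hd, hsub⟩ := mem_nhdsGT_iff_exists_Ioo_subset.1
    (hx.and (h.eventually (lt_mem_nhds (half_lt_self hc))))
  -- `x` increases faster than `c / 2 * log (t - e)`
  set y : ℝ → ℝ := fun t => x t - c / 2 * Real.log (t - e)
  have hy : ∀ t ∈ Ioo e d, HasDerivAt y (x' t - c / 2 * (1 / (t - e))) t := fun t ht =>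
    (hsub ht).1.sub
      ((((hasDerivAt_id t).sub_const e).log (sub_pos.2 ht.1).ne').const_mul (c / 2))
  have hmono : MonotoneOn y (Ioo e d) := by
    refine monotoneOn_of_hasDerivWithinAt_nonneg (convex_Ioo e d)
      (fun t ht => (hy t ht).continuousAt.continuousWithinAt)
      (fun t ht => (hy t (interior_subset ht)).hasDerivWithinAt) fun t ht => ?_
    obtain ⟨ht, hlt⟩ := And.intro (interior_subset ht) (hsub (interior_subset ht)).2
    rw [sub_nonneg, mul_one_div, div_le_iff₀ (sub_pos.2 ht.1), mul_comm]
    exact hlt.le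
  obtain ⟨m, hm⟩ := exists_between (mem_Ioi.1 hd)
  have hlog : Tendsto (fun t => y m + c / 2 * Real.log (t - e)) (𝓝[>] e) atBot := by
    have hsub0 : Tendsto (fun t => t - e) (𝓝[>] e) (𝓝[≠] 0) :=
      tendsto_nhdsWithin_iff.2
        ⟨by simpa using ((continuous_sub_right e).tendsto e).mono_left nhdsWithin_le_nhds,
          eventually_mem_nhdsWithin.mono fun t ht => (sub_pos.2 ht).ne'⟩
    exact tendsto_atBot_add_const_left _ _
      ((Real.tendsto_log_nhdsNE_zero.comp hsub0).const_mul_atBot (half_pos hc))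
  refine tendsto_atBot_mono' _ ?_ hlog
  filter_upwards [Ioo_mem_nhdsGT hm.1] with t ht
  exact sub_le_iff_le_add.1 (hmono ⟨ht.1, ht.2.trans hm.2⟩ hm ht.2.le)

theorem tendsto_div_sub_of_eq_zero {p : ℝ → ℝ} {e : ℝ} (hp : DifferentiableAt ℝ p e)
    (he : p e = 0) : Tendsto (fun t => p t / (t - e)) (𝓝[≠] e) (𝓝 (deriv p e)) :=
  (hasDerivAt_iff_tendsto_slope.1 hp.hasDerivAt).congr fun t => by
    rw [slope_def_field, he, sub_zero]

variable {p q x : ℝ → ℝ} {e : ℝ}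

theorem tendsto_atBot_nhdsGT_of_pos (he : p e = 0) (hq : ContinuousAt q e)
    (hx : ∀ᶠ t in 𝓝[>] e, HasDerivAt x (q t / p t) t) (h : 0 < q e * deriv p e) :
    Tendsto x (𝓝[>] e) atBot := by
  have hd := right_ne_zero_of_mul h.ne'
  refine tendsto_atBot_of_tendsto_sub_mul_deriv hx (div_pos_iff.2 (mul_pos_iff.1 h)) ?_
  have hres := (hq.tendsto.mono_left nhdsWithin_le_nhds).div
    (tendsto_div_sub_of_eq_zero (differentiableAt_of_deriv_ne_zero hd) he) hd
  refine (hres.mono_left (nhdsGT_le_nhdsNE e)).congr fun t => ?_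
  rw [Pi.div_apply, div_div_eq_mul_div, mul_comm, mul_div_assoc]

theorem tendsto_atTop_nhdsGT_of_neg (he : p e = 0) (hq : ContinuousAt q e)
    (hx : ∀ᶠ t in 𝓝[>] e, HasDerivAt x (q t / p t) t) (h : q e * deriv p e < 0) :
    Tendsto x (𝓝[>] e) atTop := by
  refine tendsto_neg_atBot_iff.1 (tendsto_atBot_nhdsGT_of_pos (x := fun t => -x t) he hq.neg ?_ ?_)
  · filter_upwards [hx] with t ht
    exact ht.neg.congr_deriv (neg_div _ _).symm
  · rw [Pi.neg_apply, neg_mul]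
    exact neg_pos.2 h

theorem tendsto_atBot_nhdsLT_of_pos (he : p e = 0) (hq : ContinuousAt q e)
    (hx : ∀ᶠ t in 𝓝[<] e, HasDerivAt x (q t / p t) t) (h : 0 < q e * deriv p e) :
    Tendsto x (𝓝[<] e) atBot := by
  have hreflect : Tendsto (fun s => x (-s)) (𝓝[>] (-e)) atBot := by
    refine tendsto_atBot_nhdsGT_of_pos (p := fun s => p (-s)) (q := fun s => -q (-s))
      (by simpa using he) ?_ ?_ (by simpa [deriv_comp_neg] using h)
    · exact (ContinuousAt.comp (by simpa using hq) continuousAt_neg).neg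
    · filter_upwards [tendsto_neg_nhdsGT_neg.eventually hx] with s hs
      simpa [neg_div, Function.comp_def] using hs.scomp s (hasDerivAt_neg s)
  simpa [Function.comp_def] using hreflect.comp (tendsto_neg_nhdsLT (a := e))

theorem tendsto_atTop_nhdsLT_of_neg (he : p e = 0) (hq : ContinuousAt q e)
    (hx : ∀ᶠ t in 𝓝[<] e, HasDerivAt x (q t / p t) t) (h : q e * deriv p e < 0) :
    Tendsto x (𝓝[<] e) atTop := by
  refine tendsto_neg_atBot_iff.1 (tendsto_atBot_nhdsLT_of_pos (x := fun t => -x t) he hq.neg ?_ ?_)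
  · filter_upwards [hx] with t ht
    exact ht.neg.congr_deriv (neg_div _ _).symm
  · rw [Pi.neg_apply, neg_mul]
    exact neg_pos.2 h

end Asymptotics

section ConsecutiveZeros

theorem mul_pos_of_isPreconnected {α : Type*} [TopologicalSpace α] {S : Set α} {f : α → ℝ}
    (hS : IsPreconnected S) (hf : ContinuousOn f S) (h0 : ∀ r ∈ S, f r ≠ 0) {s t : α} (hs : s ∈ S)
    (ht : t ∈ S) : 0 < f s * f t := by
  by_contra! h
  have hzero : (0 : ℝ) ∈ f '' S := by
    rcases mul_nonpos_iff.1 h with h | h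
    · exact hS.intermediate_value ht hs hf ⟨h.2, h.1⟩
    · exact hS.intermediate_value hs ht hf h
  obtain ⟨r, hr, hr0⟩ := hzero
  exact h0 r hr hr0

/-- `a < b` are zeros of `p` with no zero of `p` in between, that is, `]a, b[ × ℝ` is one of the
strips of the theorem. -/
structure ConsecutiveZeros (p : ℝ → ℝ) (a b : ℝ) : Prop where
  lt : a < b
  left : p a = 0
  right : p b = 0
  ne_zero : ∀ s ∈ Ioo a b, p s ≠ 0

variable {p q : ℝ → ℝ} {a b : ℝ}

theorem eventually_deriv_mul_sub_mul_pos {e : ℝ} (he : p e = 0) (hd : deriv p e ≠ 0) :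
    ∀ᶠ t in 𝓝[≠] e, 0 < deriv p e * (t - e) * p t := by
  have hlim := (tendsto_div_sub_of_eq_zero (differentiableAt_of_deriv_ne_zero hd) he).const_mul
    (deriv p e)
  filter_upwards [hlim.eventually (lt_mem_nhds (mul_self_pos.2 hd)), self_mem_nhdsWithin]
    with t ht hte
  have hsq := mul_pos ht (pow_two_pos_of_ne_zero (sub_ne_zero.2 hte))
  field_simp at hsq
  rwa [mul_right_comm]

theorem ConsecutiveZeros.deriv_mul_deriv_neg (h : ConsecutiveZeros p a b)
    (hp : ContinuousOn p (Ioo a b)) (ha : deriv p a ≠ 0) (hb : deriv p b ≠ 0) :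
    deriv p a * deriv p b < 0 := by
  obtain ⟨s, hsa, hs⟩ := (((eventually_deriv_mul_sub_mul_pos h.left ha).filter_mono
    (nhdsGT_le_nhdsNE a)).and (Ioo_mem_nhdsGT h.lt)).exists
  obtain ⟨t, htb, ht⟩ := (((eventually_deriv_mul_sub_mul_pos h.right hb).filter_mono
    (nhdsLT_le_nhdsNE b)).and (Ioo_mem_nhdsLT h.lt)).exists
  have hst : 0 < p s * p t := mul_pos_of_isPreconnected isPreconnected_Ioo hp h.ne_zero hs ht
  have hprod : 0 < deriv p a * deriv p b * ((p s * p t) * ((s - a) * (t - b))) := by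
    linear_combination mul_pos hsa htb
  exact neg_of_mul_pos_left hprod
    (mul_neg_of_pos_of_neg hst (mul_neg_of_pos_of_neg (sub_pos.2 hs.1) (sub_neg.2 ht.2))).le

theorem ConsecutiveZeros.eventually_left (h : ConsecutiveZeros p a b) {P : ℝ → Prop}
    (hP : ∀ t ∈ Ioo a b, P t) : ∀ᶠ t in 𝓝[>] a, P t :=
  eventually_of_mem (Ioo_mem_nhdsGT h.lt) hP

theorem ConsecutiveZeros.eventually_right (h : ConsecutiveZeros p a b) {P : ℝ → Prop}
    (hP : ∀ t ∈ Ioo a b, P t) : ∀ᶠ t in 𝓝[<] b, P t :=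
  eventually_of_mem (Ioo_mem_nhdsLT h.lt) hP

/-- The strip `]a, b[ × ℝ` is a separatrix for `p ∂ₜ + q ∂ₓ`. The point `(τ, y)` through which a
characteristic passes is not recorded, because the condition is on all characteristics. -/
def IsSeparatrixStrip (p q : ℝ → ℝ) (a b : ℝ) : Prop :=
  ∀ x : ℝ → ℝ, (∀ t ∈ Ioo a b, HasDerivAt x (q t / p t) t) →
    (Tendsto x (𝓝[>] a) atTop ∧ Tendsto x (𝓝[<] b) atTop) ∨
    (Tendsto x (𝓝[>] a) atBot ∧ Tendsto x (𝓝[<] b) atBot)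

theorem isSeparatrix_iff {p q : ℝ[X]} (hab : a < b) :
    IsSeparatrix p q a b ↔ IsSeparatrixStrip (fun s => p.eval s) (fun s => q.eval s) a b := by
  refine ⟨fun h x hx => ?_, fun h τ _ y x hx => h x hx.1⟩
  obtain ⟨τ, hτ⟩ := exists_between hab
  exact h τ hτ (x τ) x ⟨hx, rfl⟩

theorem ConsecutiveZeros.isSeparatrixStrip (h : ConsecutiveZeros p a b)
    (hp : ContinuousOn p (Ioo a b)) (ha : deriv p a ≠ 0) (hb : deriv p b ≠ 0)
    (hqa : ContinuousAt q a) (hqb : ContinuousAt q b) (hq : q a * q b < 0) :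
    IsSeparatrixStrip p q a b := by
  intro x hx
  have hxa := h.eventually_left hx
  have hxb := h.eventually_right hx
  have hmul : 0 < (q a * deriv p a) * (q b * deriv p b) := by
    linear_combination mul_pos_of_neg_of_neg hq (h.deriv_mul_deriv_neg hp ha hb)
  rcases pos_and_pos_or_neg_and_neg_of_mul_pos hmul with ⟨ha, hb⟩ | ⟨ha, hb⟩
  · exact Or.inr ⟨tendsto_atBot_nhdsGT_of_pos h.left hqa hxa ha,
      tendsto_atBot_nhdsLT_of_pos h.right hqb hxb hb⟩
  · exact Or.inl ⟨tendsto_atTop_nhdsGT_of_neg h.left hqa hxa ha,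
      tendsto_atTop_nhdsLT_of_neg h.right hqb hxb hb⟩

end ConsecutiveZeros

section NonSurjectivity

theorem atTop_le_map {α δ ι : Type*} [TopologicalSpace α] [LinearOrder δ] [TopologicalSpace δ]
    [OrderClosedTopology δ] {l : Filter α} [NeBot l] {P : ι → Prop} {S : ι → Set α}
    (hl : l.HasBasis P S) (hS : ∀ i, P i → IsPreconnected (S i)) {X : α → δ} {U : Set α}
    (hU : U ∈ l) (hX : ContinuousOn X U) (h : Tendsto X l atTop) : atTop ≤ map X l := by
  intro V hV
  obtain ⟨i, hi, hiV⟩ := hl.mem_iff.1 (inter_mem hV hU)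
  obtain ⟨z, hz⟩ := Filter.nonempty_of_mem (hl.mem_of_mem hi)
  refine mem_of_superset (Ici_mem_atTop (X z)) (((hS i hi).intermediate_value_Ici hz
    (le_principal_iff.2 (hl.mem_of_mem hi)) (hX.mono fun r hr => (hiV hr).2) h).trans ?_)
  exact image_subset_iff.2 fun r hr => (hiV hr).1

theorem atBot_le_map {α δ ι : Type*} [TopologicalSpace α] [LinearOrder δ] [TopologicalSpace δ]
    [OrderClosedTopology δ] {l : Filter α} [NeBot l] {P : ι → Prop} {S : ι → Set α}
    (hl : l.HasBasis P S) (hS : ∀ i, P i → IsPreconnected (S i)) {X : α → δ} {U : Set α}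
    (hU : U ∈ l) (hX : ContinuousOn X U) (h : Tendsto X l atBot) : atBot ≤ map X l :=
  atTop_le_map (δ := δᵒᵈ) hl hS hU hX h

theorem frequently_eq_of_le_map {α β δ : Type*} {l : Filter α} {l' : Filter β} {F : Filter δ}
    [NeBot F] {X : α → δ} {Y : β → δ} (hX : F ≤ map X l) (hY : F ≤ map Y l') :
    ∃ᶠ z in l ×ˢ l', X z.1 = Y z.2 := by
  intro h
  obtain ⟨P, hP, Q, hQ, hPQ⟩ := eventually_prod_iff.1 h
  obtain ⟨_, ⟨s, hs, rfl⟩, t, ht, hst⟩ :=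
    Filter.nonempty_of_mem (inter_mem (hX (image_mem_map hP)) (hY (image_mem_map hQ)))
  exact hPQ hs ht hst.symm

theorem exists_primitive_of_continuousOn_Ioo {g : ℝ → ℝ} {a b : ℝ}
    (hg : ContinuousOn g (Ioo a b)) : ∃ X : ℝ → ℝ, ∀ t ∈ Ioo a b, HasDerivAt X (g t) t := by
  rcases (Ioo a b).eq_empty_or_nonempty with hab | ⟨c, hc⟩
  · exact ⟨id, by simp [hab]⟩
  refine ⟨fun t => ∫ r in c..t, g r, fun t ht => ?_⟩
  exact intervalIntegral.integral_hasDerivAt_right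
    (hg.mono (ordConnected_Ioo.uIcc_subset hc ht)).intervalIntegrable
    (hg.stronglyMeasurableAtFilter isOpen_Ioo t ht) (hg.continuousAt (isOpen_Ioo.mem_nhds ht))

variable {p q : ℝ → ℝ} {a b : ℝ}

theorem IsSeparatrixStrip.frequently_eq (hab : a < b) (h : IsSeparatrixStrip p q a b) {X : ℝ → ℝ}
    (hX : ∀ t ∈ Ioo a b, HasDerivAt X (q t / p t) t) :
    ∃ᶠ z in 𝓝[>] a ×ˢ 𝓝[<] b, X z.1 = X z.2 := by
  have hXc : ContinuousOn X (Ioo a b) := fun t ht => (hX t ht).continuousAt.continuousWithinAt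
  have ha := Ioo_mem_nhdsGT hab
  have hb := Ioo_mem_nhdsLT hab
  have hGT := nhdsGT_basis a
  have hLT := nhdsLT_basis b
  rcases h X hX with ⟨hXa, hXb⟩ | ⟨hXa, hXb⟩
  · exact frequently_eq_of_le_map (atTop_le_map hGT (fun _ _ => isPreconnected_Ioo) ha hXc hXa)
      (atTop_le_map hLT (fun _ _ => isPreconnected_Ioo) hb hXc hXb)
  · exact frequently_eq_of_le_map (atBot_le_map hGT (fun _ _ => isPreconnected_Ioo) ha hXc hXa)
      (atBot_le_map hLT (fun _ _ => isPreconnected_Ioo) hb hXc hXb)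

theorem ConsecutiveZeros.tendsto_abs_travelTime (h : ConsecutiveZeros p a b)
    (hp : ContinuousOn p (Ioo a b)) (ha : deriv p a ≠ 0) (hb : deriv p b ≠ 0) {T : ℝ → ℝ}
    (hT : ∀ t ∈ Ioo a b, HasDerivAt T (1 / p t) t) :
    Tendsto (fun z : ℝ × ℝ => |T z.2 - T z.1|) (𝓝[>] a ×ˢ 𝓝[<] b) atTop := by
  have hTa := h.eventually_left hT
  have hTb := h.eventually_right hT
  rcases mul_neg_iff.1 (h.deriv_mul_deriv_neg hp ha hb) with ⟨ha, hb⟩ | ⟨ha, hb⟩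
  · have hbot := tendsto_atBot_nhdsGT_of_pos (q := 1) h.left continuousAt_const hTa (by simpa)
    have htop := tendsto_atTop_nhdsLT_of_neg (q := 1) h.right continuousAt_const hTb (by simpa)
    exact tendsto_abs_atTop_atTop.comp ((htop.comp tendsto_snd).atTop_add_atTop
      (tendsto_neg_atBot_atTop.comp (hbot.comp tendsto_fst)))
  · have htop := tendsto_atTop_nhdsGT_of_neg (q := 1) h.left continuousAt_const hTa (by simpa)
    have hbot := tendsto_atBot_nhdsLT_of_pos (q := 1) h.right continuousAt_const hTb (by simpa)
    exact tendsto_abs_atBot_atTop.comp ((hbot.comp tendsto_snd).atBot_add_atBot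
      (tendsto_neg_atTop_atBot.comp (htop.comp tendsto_fst)))

variable {E : Type*} [NormedAddCommGroup E] [NormedSpace ℝ E]

theorem sub_eq_travelTime_smul {u : ℝ × ℝ → E} {e : E} (hu : Differentiable ℝ u)
    (hLu : ∀ z, fderiv ℝ u z (p z.1, q z.1) = e) (hp : ∀ r ∈ Ioo a b, p r ≠ 0) {X T : ℝ → ℝ}
    (hX : ∀ r ∈ Ioo a b, HasDerivAt X (q r / p r) r)
    (hT : ∀ r ∈ Ioo a b, HasDerivAt T (1 / p r) r) {s t : ℝ} (hs : s ∈ Ioo a b)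
    (ht : t ∈ Ioo a b) : u (t, X t) - u (s, X s) = (T t - T s) • e := by
  have hcurve : ∀ r ∈ Ioo a b, HasDerivAt (fun r => u (r, X r) - T r • e) 0 r := fun r hr => by
    refine ((hasDerivAt_comp_prodMk (hu _) (hasDerivAt_id' r) (hX r hr)).sub
      ((hT r hr).smul_const e)).congr_deriv ?_
    have hdir : ((1 : ℝ), q r / p r) = (1 / p r) • (p r, q r) := by
      simp [Prod.smul_mk, hp r hr, div_eq_inv_mul]
    rw [hdir, map_smul, hLu (r, X r), sub_self]
  have hconst := (convex_Ioo a b).norm_image_sub_le_of_norm_hasDerivWithin_le (C := 0)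
    (fun r hr => (hcurve r hr).hasDerivWithinAt) (fun r _ => norm_zero.le) hs ht
  rw [zero_mul, norm_le_zero_iff, sub_eq_zero, sub_eq_sub_iff_sub_eq_sub] at hconst
  rw [hconst, sub_smul]

theorem not_isSmoothlySurjective_of_isSeparatrixStrip [Nontrivial E] (h : ConsecutiveZeros p a b)
    (hp : ContinuousOn p (Ioo a b)) (ha : deriv p a ≠ 0) (hb : deriv p b ≠ 0)
    (hq : ContinuousOn q (Ioo a b)) (hS : IsSeparatrixStrip p q a b) :
    ¬ IsSmoothlySurjective E p q := by
  intro hsurj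
  obtain ⟨e, he⟩ := exists_ne (0 : E)
  obtain ⟨u, hu, hLu⟩ := hsurj (fun _ => e) contDiff_const
  obtain ⟨X, hX⟩ := exists_primitive_of_continuousOn_Ioo (hq.div hp h.ne_zero)
  obtain ⟨T, hT⟩ := exists_primitive_of_continuousOn_Ioo (continuousOn_const.div hp h.ne_zero)
  obtain ⟨B, hB⟩ := (isCompact_Icc (a := a) (b := b)).exists_bound_of_continuousOn
    (f := fun t => u (t, 0)) (hu.continuous.comp (by fun_prop)).continuousOn
  have htime := (h.tendsto_abs_travelTime hp ha hb hT).atTop_mul_const (norm_pos_iff.2 he)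
  obtain ⟨⟨s, t⟩, hst : X s = X t, hlarge : B + B < |T t - T s| * ‖e‖, hs, ht⟩ :=
    ((hS.frequently_eq h.lt hX).and_eventually ((htime.eventually_gt_atTop (B + B)).and
      (prod_mem_prod (Ioo_mem_nhdsGT h.lt) (Ioo_mem_nhdsLT h.lt)))).exists
  have hjump : u (t, 0) - u (s, 0) = (T t - T s) • e := by
    simpa [hst] using sub_eq_travelTime_smul (hu.differentiable (by simp)) hLu h.ne_zero
      (fun r hr => (hX r hr).sub_const (X s)) hT hs ht
  refine hlarge.not_ge ?_
  calc |T t - T s| * ‖e‖ = ‖u (t, 0) - u (s, 0)‖ := by rw [hjump, norm_smul, Real.norm_eq_abs]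
    _ ≤ B + B := norm_sub_le_of_le (hB t (Ioo_subset_Icc_self ht)) (hB s (Ioo_subset_Icc_self hs))

end NonSurjectivity

section Signs

theorem exists_consecutiveZeros_mul_neg_of_lt {p q : ℝ → ℝ} {a b : ℝ} (hp : Continuous p)
    (hq : Continuous q) (hpq : ∀ s, p s = 0 → q s ≠ 0) (hab : a < b) (ha : p a = 0)
    (hb : p b = 0) (h : q a * q b < 0) :
    ∃ c d, ConsecutiveZeros p c d ∧ q c * q d < 0 := by
  have hqa := left_ne_zero_of_mul h.ne
  -- `c` is the last zero of `p` before `b` at which `q` has the sign it has at `a`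
  obtain ⟨c, ⟨⟨hac, hcb⟩, hc, hqc⟩, hcmax⟩ :
      ∃ c, IsGreatest {s ∈ Icc a b | p s = 0 ∧ 0 ≤ q s * q a} c :=
    (isCompact_Icc.inter_right ((isClosed_eq hp continuous_const).inter
      (isClosed_le (g := fun s => q s * q a) continuous_const (by fun_prop)))).exists_isGreatest
      ⟨a, left_mem_Icc.2 hab.le, ha, (mul_self_pos.2 hqa).le⟩
  obtain ⟨d, ⟨⟨hcd, hdb⟩, hd, hqd⟩, hdmin⟩ :
      ∃ d, IsLeast {s ∈ Icc c b | p s = 0 ∧ q s * q a ≤ 0} d :=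
    (isCompact_Icc.inter_right ((isClosed_eq hp continuous_const).inter
      (isClosed_le (f := fun s => q s * q a) (by fun_prop) continuous_const))).exists_isLeast
      ⟨b, right_mem_Icc.2 hcb, hb, (mul_comm _ _).trans_le h.le⟩
  have hqc' := hqc.lt_of_ne' (mul_ne_zero (hpq c hc) hqa)
  have hqd' := hqd.lt_of_ne (mul_ne_zero (hpq d hd) hqa)
  refine ⟨c, d, ⟨hcd.lt_of_ne ?_, hc, hd, fun s hs h0 => ?_⟩, ?_⟩
  · rintro rfl
    exact hqc'.not_gt hqd'
  · rcases le_total 0 (q s * q a) with hqs | hqs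
    · exact hs.1.not_ge (hcmax ⟨⟨hac.trans hs.1.le, hs.2.le.trans hdb⟩, h0, hqs⟩)
    · exact hs.2.not_ge (hdmin ⟨⟨hs.1.le, hs.2.le.trans hdb⟩, h0, hqs⟩)
  · refine neg_of_mul_neg_left (b := q a * q a) ?_ (mul_self_nonneg _)
    linear_combination mul_neg_of_pos_of_neg hqc' hqd'

theorem exists_consecutiveZeros_mul_neg {p q : ℝ → ℝ} {a b : ℝ} (hp : Continuous p)
    (hq : Continuous q) (hpq : ∀ s, p s = 0 → q s ≠ 0) (ha : p a = 0) (hb : p b = 0)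
    (h : q a * q b < 0) : ∃ c d, ConsecutiveZeros p c d ∧ q c * q d < 0 := by
  rcases lt_trichotomy a b with hab | rfl | hab
  · exact exists_consecutiveZeros_mul_neg_of_lt hp hq hpq hab ha hb h
  · exact absurd h (mul_self_nonneg _).not_gt
  · exact exists_consecutiveZeros_mul_neg_of_lt hp hq hpq hab hb ha (mul_comm (q a) _ ▸ h)

variable {f : ℝ → ℝ} {a b θ : ℝ}

theorem OppositeSigns.mul_neg (h : OppositeSigns f a θ b) (hf : ContinuousOn f (Icc a b))
    (hθ : θ ∈ Ioo a b) (ha : f a ≠ 0) (hb : f b ≠ 0) : f a * f b < 0 := by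
  obtain ⟨s, hs⟩ := exists_between hθ.1
  obtain ⟨t, ht⟩ := exists_between hθ.2
  have hfL : ContinuousOn f (Ico a θ) :=
    hf.mono (Ico_subset_Icc_self.trans (Icc_subset_Icc_right hθ.2.le))
  have hfR : ContinuousOn f (Ioc θ b) :=
    hf.mono (Ioc_subset_Icc_self.trans (Icc_subset_Icc_left hθ.1.le))
  have hL (h0 : ∀ r ∈ Ioo a θ, f r ≠ 0) : 0 < f a * f s :=
    mul_pos_of_isPreconnected isPreconnected_Ico hfL
      (fun r hr => hr.1.eq_or_lt.elim (fun e => e ▸ ha) fun hlt => h0 r ⟨hlt, hr.2⟩)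
      (left_mem_Ico.2 hθ.1) (Ioo_subset_Ico_self hs)
  have hR (h0 : ∀ r ∈ Ioo θ b, f r ≠ 0) : 0 < f t * f b :=
    mul_pos_of_isPreconnected isPreconnected_Ioc hfR
      (fun r hr => hr.2.eq_or_lt.elim (fun e => e ▸ hb) fun hlt => h0 r ⟨hr.1, hlt⟩)
      (Ioo_subset_Ioc_self ht) (right_mem_Ioc.2 hθ.2)
  rcases h with ⟨hl, hr⟩ | ⟨hl, hr⟩
  · exact mul_neg_of_pos_of_neg
      ((pos_iff_pos_of_mul_pos (hL fun r hr => (hl r hr).ne')).2 (hl s hs))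
      ((neg_iff_neg_of_mul_pos (hR fun s hs => (hr s hs).ne)).1 (hr t ht))
  · exact mul_neg_of_neg_of_pos
      ((neg_iff_neg_of_mul_pos (hL fun r hr => (hl r hr).ne)).2 (hl s hs))
      ((pos_iff_pos_of_mul_pos (hR fun s hs => (hr s hs).ne')).1 (hr t ht))

theorem exists_oppositeSigns_of_mul_neg (hf : ContinuousOn f (Icc a b)) (hab : a < b)
    (h : f a * f b < 0) (hz : {s | s ∈ Ioo a b ∧ f s = 0}.Subsingleton) :
    ∃ θ ∈ Ioo a b, f θ = 0 ∧ OppositeSigns f a θ b := by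
  have ha : a ∈ Icc a b := left_mem_Icc.2 hab.le
  have hb : b ∈ Icc a b := right_mem_Icc.2 hab.le
  have hIoo : ∀ r ∈ Icc a b, f r = 0 → r ∈ Ioo a b := fun r hr h0 =>
    ⟨hr.1.lt_of_ne (by rintro rfl; simp [h0] at h), hr.2.lt_of_ne (by rintro rfl; simp [h0] at h)⟩
  obtain ⟨θ, hθI, h0⟩ : ∃ θ ∈ Icc a b, f θ = 0 := by
    by_contra! hne
    exact h.not_gt (mul_pos_of_isPreconnected isPreconnected_Icc hf hne ha hb)
  have hθ := hIoo θ hθI h0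
  have hne : ∀ r ∈ Icc a b, r ≠ θ → f r ≠ 0 := fun r hr hrθ hr0 =>
    hrθ (hz ⟨hIoo r hr hr0, hr0⟩ ⟨hθ, h0⟩)
  have hsubL : Ico a θ ⊆ Icc a b := Ico_subset_Icc_self.trans (Icc_subset_Icc_right hθ.2.le)
  have hsubR : Ioc θ b ⊆ Icc a b := Ioc_subset_Icc_self.trans (Icc_subset_Icc_left hθ.1.le)
  have hL : ∀ s ∈ Ioo a θ, 0 < f a * f s := fun s hs =>
    mul_pos_of_isPreconnected isPreconnected_Ico (hf.mono hsubL)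
      (fun r hr => hne r (hsubL hr) hr.2.ne) (left_mem_Ico.2 hθ.1) (Ioo_subset_Ico_self hs)
  have hR : ∀ s ∈ Ioo θ b, 0 < f s * f b := fun s hs =>
    mul_pos_of_isPreconnected isPreconnected_Ioc (hf.mono hsubR)
      (fun r hr => hne r (hsubR hr) hr.1.ne') (Ioo_subset_Ioc_self hs) (right_mem_Ioc.2 hθ.2)
  refine ⟨θ, hθ, h0, (mul_neg_iff.1 h).imp (fun h => ⟨fun s hs => ?_, fun s hs => ?_⟩)
    fun h => ⟨fun s hs => ?_, fun s hs => ?_⟩⟩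
  · exact (pos_iff_pos_of_mul_pos (hL s hs)).1 h.1
  · exact (neg_iff_neg_of_mul_pos (hR s hs)).2 h.2
  · exact (neg_iff_neg_of_mul_pos (hL s hs)).1 h.1
  · exact (pos_iff_pos_of_mul_pos (hR s hs)).2 h.2

theorem mul_neg_iff_exists_oppositeSigns (hf : ContinuousOn f (Icc a b)) (hab : a < b)
    (ha : f a ≠ 0) (hb : f b ≠ 0) (hz : {s | s ∈ Ioo a b ∧ f s = 0}.Subsingleton) :
    f a * f b < 0 ↔ ∃ θ ∈ Ioo a b, f θ = 0 ∧ OppositeSigns f a θ b :=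
  ⟨fun h => exists_oppositeSigns_of_mul_neg hf hab h hz,
    fun ⟨_, hθ, _, h⟩ => h.mul_neg hf hθ ha hb⟩

end Signs

theorem theorem1p1_general (E : Type*) [NormedAddCommGroup E] [NormedSpace ℝ E] [CompleteSpace E]
    [Nontrivial E] {p q : ℝ → ℝ} (hp : ContDiff ℝ ∞ p) (hq : ContDiff ℝ ∞ q)
    (hpq : ∀ s, p s = 0 → q s ≠ 0) (hd : ∀ s, p s = 0 → deriv p s ≠ 0) :
    List.TFAE
      [¬ IsSmoothlySurjective E p q,
       ∃ a b, ConsecutiveZeros p a b ∧ IsSeparatrixStrip p q a b,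
       ∃ a b, ConsecutiveZeros p a b ∧ q a * q b < 0,
       ∃ a b, p a = 0 ∧ p b = 0 ∧ q a * q b < 0] := by
  tfae_have 2 → 1 := fun ⟨a, b, h, hS⟩ => not_isSmoothlySurjective_of_isSeparatrixStrip h
    hp.continuous.continuousOn (hd a h.left) (hd b h.right) hq.continuous.continuousOn hS
  tfae_have 3 → 2 := fun ⟨a, b, h, hneg⟩ => ⟨a, b, h, h.isSeparatrixStrip
    hp.continuous.continuousOn (hd a h.left) (hd b h.right) hq.continuous.continuousAt
    hq.continuous.continuousAt hneg⟩
  tfae_have 4 → 3 := fun ⟨_, _, ha, hb, hneg⟩ =>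
    exists_consecutiveZeros_mul_neg hp.continuous hq.continuous hpq ha hb hneg
  tfae_have 1 → 4 := by
    contrapose!
    exact fun hpos => .of_mul_pos_at_zeros hp hq fun a b ha hb =>
      (hpos a b ha hb).lt_of_ne' (mul_ne_zero (hpq a ha) (hpq b hb))
  tfae_finish

theorem exists_consecutiveZeros_iff {p : ℝ → ℝ} {N : ℕ} {t : Fin N → ℝ} (ht : StrictMono t)
    (hp : ∀ s, p s = 0 ↔ ∃ j, s = t j) {P : ℝ → ℝ → Prop} :
    (∃ a b, ConsecutiveZeros p a b ∧ P a b) ↔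
      ∃ (j : ℕ) (hj : j + 1 < N), P (t ⟨j, Nat.lt_of_succ_lt hj⟩) (t ⟨j + 1, hj⟩) := by
  constructor
  · rintro ⟨a, b, h, hP⟩
    obtain ⟨i, rfl⟩ := (hp a).1 h.left
    obtain ⟨k, rfl⟩ := (hp b).1 h.right
    have hik : i < k := ht.lt_iff_lt.1 h.lt
    have hi : (i : ℕ) + 1 < N := (Nat.succ_le_of_lt hik).trans_lt k.2
    have hk : k = ⟨i + 1, hi⟩ := by
      refine (le_of_not_gt fun hlt => ?_).antisymm hik
      exact h.ne_zero _ ⟨ht (Nat.lt_succ_self i), ht hlt⟩ ((hp _).2 ⟨_, rfl⟩)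
    exact ⟨i, hi, hk ▸ hP⟩
  · rintro ⟨j, hj, hP⟩
    refine ⟨_, _, ⟨ht (Fin.mk_lt_mk.2 j.lt_succ_self), (hp _).2 ⟨_, rfl⟩, (hp _).2 ⟨_, rfl⟩,
      fun s hs h0 => ?_⟩, hP⟩
    obtain ⟨⟨i, hi⟩, rfl⟩ := (hp s).1 h0
    exact (Fin.mk_lt_mk.1 (ht.lt_iff_lt.1 hs.1)).not_ge
      (Nat.le_of_lt_succ (Fin.mk_lt_mk.1 (ht.lt_iff_lt.1 hs.2)))

section Polynomials

variable (𝕜 : Type*) [RCLike 𝕜] {p q : ℝ[X]}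

theorem tfae_not_surjectiveOnSmooth (hpq : ∀ s : ℝ, ¬ (p.eval s = 0 ∧ q.eval s = 0))
    (hd : ∀ s, p.eval s = 0 → p.derivative.eval s ≠ 0) :
    List.TFAE
      [¬ SurjectiveOnSmooth 𝕜 p q,
       ∃ a b, ConsecutiveZeros (fun s => p.eval s) a b ∧ IsSeparatrix p q a b,
       ∃ a b, ConsecutiveZeros (fun s => p.eval s) a b ∧ q.eval a * q.eval b < 0,
       ∃ a b, p.eval a = 0 ∧ p.eval b = 0 ∧ q.eval a * q.eval b < 0] := by
  have hsep (a b : ℝ) : ConsecutiveZeros (fun s => p.eval s) a b ∧ IsSeparatrix p q a b ↔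
      ConsecutiveZeros (fun s => p.eval s) a b ∧
        IsSeparatrixStrip (fun s => p.eval s) (fun s => q.eval s) a b :=
    and_congr_right fun h => isSeparatrix_iff h.lt
  simp only [surjectiveOnSmooth_iff, hsep]
  exact theorem1p1_general 𝕜 (p.contDiff_aeval ∞) (q.contDiff_aeval ∞) (fun s h h' => hpq s ⟨h, h'⟩)
    fun s h => by simpa only [Polynomial.deriv] using hd s h

theorem tfae_not_surjectiveOnSmooth_of_strictMono {N : ℕ} {t : Fin N → ℝ} (ht : StrictMono t)
    (hpq : ∀ s : ℝ, ¬ (p.eval s = 0 ∧ q.eval s = 0)) (hp : ∀ s : ℝ, p.eval s = 0 ↔ ∃ j, s = t j)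
    (hd : ∀ j, p.derivative.eval (t j) ≠ 0)
    (hq : ∀ (j : ℕ) (hj : j + 1 < N),
      {s | s ∈ Ioo (t ⟨j, Nat.lt_of_succ_lt hj⟩) (t ⟨j + 1, hj⟩) ∧ q.eval s = 0}.Subsingleton) :
    List.TFAE
      [¬ SurjectiveOnSmooth 𝕜 p q,
       ∃ (j : ℕ) (hj : j + 1 < N), IsSeparatrix p q (t ⟨j, Nat.lt_of_succ_lt hj⟩) (t ⟨j + 1, hj⟩),
       ∃ (j : ℕ) (hj : j + 1 < N), ∃ θ ∈ Ioo (t ⟨j, Nat.lt_of_succ_lt hj⟩) (t ⟨j + 1, hj⟩),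
         q.eval θ = 0 ∧
           OppositeSigns (fun s => q.eval s) (t ⟨j, Nat.lt_of_succ_lt hj⟩) θ (t ⟨j + 1, hj⟩)] := by
  have hd' : ∀ s, p.eval s = 0 → p.derivative.eval s ≠ 0 := fun s h0 => by
    obtain ⟨j, rfl⟩ := (hp s).1 h0
    exact hd j
  have hqt (j) : q.eval (t j) ≠ 0 := fun h => hpq _ ⟨(hp _).2 ⟨j, rfl⟩, h⟩
  have hsigns (j : ℕ) (hj : j + 1 < N) :=
    mul_neg_iff_exists_oppositeSigns q.continuous.continuousOn (ht (Fin.mk_lt_mk.2 j.lt_succ_self))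
      (hqt _) (hqt _) (hq j hj)
  have h := tfae_not_surjectiveOnSmooth 𝕜 hpq hd'
  simp only [exists_consecutiveZeros_iff ht hp] at h
  simp only [← hsigns]
  tfae_have 1 ↔ 2 := h.out 0 1
  tfae_have 1 ↔ 3 := h.out 0 2
  tfae_finish

theorem not_surjectiveOnSmooth_iff_odd {lam : ℝ} (hlam : lam ≠ 0) (k : ℕ) :
    ¬ SurjectiveOnSmooth 𝕜 (1 - X ^ 2) (C lam * X ^ k) ↔ Odd k := by
  have hzero (s : ℝ) : (1 - X ^ 2 : ℝ[X]).eval s = 0 ↔ s = 1 ∨ s = -1 := by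
    rw [← sq_eq_one_iff, eval_sub, eval_one, eval_X_pow, sub_eq_zero, eq_comm]
  have hne : ∀ s : ℝ, (1 - X ^ 2 : ℝ[X]).eval s = 0 → s ≠ 0 := fun s h => by
    rintro rfl
    simp at h
  have htfae := tfae_not_surjectiveOnSmooth 𝕜 (p := 1 - X ^ 2) (q := C lam * X ^ k)
    (fun s h => by simpa [hlam, hne s h.1] using h.2)
    fun s h => by simpa [derivative_X_pow] using hne s h
  have hsq : 0 < lam * lam := mul_self_pos.2 hlam
  have hiff := htfae.out 0 3
  refine hiff.trans ⟨fun ⟨a, b, ha, hb, hneg⟩ => ?_, fun hk => ?_⟩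
  · by_contra hk
    have heval : ∀ s : ℝ, (1 - X ^ 2 : ℝ[X]).eval s = 0 → (C lam * X ^ k : ℝ[X]).eval s = lam :=
      fun s hs => by
        rcases (hzero s).1 hs with rfl | rfl <;> simp [(Nat.not_odd_iff_even.1 hk).neg_one_pow]
    rw [heval a ha, heval b hb] at hneg
    exact hneg.not_gt hsq
  · exact ⟨1, -1, by simp, by simp, by simpa [hk.neg_one_pow] using hsq⟩

end Polynomials

theorem theorem1p1 (𝕜 : Type*) [RCLike 𝕜] :
    (∀ (N : ℕ) (_ : 2 ≤ N) (p q : ℝ[X]) (t : Fin N → ℝ),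
      StrictMono t →
      (∀ s : ℝ, ¬ (p.eval s = 0 ∧ q.eval s = 0)) →
      (∀ s : ℝ, p.eval s = 0 ↔ ∃ j, s = t j) →
      (∀ j, p.derivative.eval (t j) ≠ 0) →
      (∀ (j : ℕ) (hj : j + 1 < N),
        {s | s ∈ Ioo (t ⟨j, by omega⟩) (t ⟨j + 1, hj⟩) ∧ q.eval s = 0}.Subsingleton) →
      List.TFAE
        [¬ SurjectiveOnSmooth 𝕜 p q,
         ∃ (j : ℕ) (hj : j + 1 < N), IsSeparatrix p q (t ⟨j, by omega⟩) (t ⟨j + 1, hj⟩),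
         ∃ (j : ℕ) (hj : j + 1 < N), ∃ θ ∈ Ioo (t ⟨j, by omega⟩) (t ⟨j + 1, hj⟩),
           q.eval θ = 0 ∧
             OppositeSigns (fun s => q.eval s) (t ⟨j, by omega⟩) θ (t ⟨j + 1, hj⟩)]) ∧
    (∀ (lam : ℝ) (k : ℕ), lam ≠ 0 →
      (¬ SurjectiveOnSmooth 𝕜 (1 - X ^ 2) (C lam * X ^ k) ↔ Odd k)) := by
  exact ⟨fun _ _ _ _ _ ht hpq hp hd hq =>
      tfae_not_surjectiveOnSmooth_of_strictMono 𝕜 ht hpq hp hd hq,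
    fun _ k hlam => not_surjectiveOnSmooth_iff_odd 𝕜 hlam k⟩
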